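/- Let $P$ and $Q$ be finite posets. A $k$-chain (resp. $k$-antichain) of a finite poset $R$ is a union of $k$ pairwise disjoint, possibly empty, chains (resp. antichains) of $R$; let $c_k(R)$ (resp. $d_k(R)$) be the maximum size of a $k$-chain (resp. $k$-antichain) of $R$. Let $h(R)$ be the maximum size of a chain and $w_R$ the maximum size of an antichain of $R$. Let $\lambda^R=(\lambda^R_1,\dots,\lambda^R_{w_R})$ be the partition of $|R|$ determined by $c_k(R)=\lambda^R_1+\dots+\lambda^R_k$ for all $k\le w_R$, and let $\mu^R$ be its conjugate, $\mu^R_j=|\{i\le w_R : \lambda^R_i\ge j\}|$. Call $R$ $c$-decomposable if it has a partition into chains $C_1,\dots,C_{w_R}$ with $|C_1\cup\dots\cup C_k|=c_k(R)$ for each $k$, and $d$-decomposable if it has a partition into antichains $A_1,\dots,A_{h(R)}$ with $|A_1\cup\dots\cup A_k|=d_k(R)$ for each $k$. A uniantichain of $P\times Q$ (with the componentwise order) is an antichain of $P\times Q$ in which one of the two coordinates is constant; a semichain is a set $T\subseteq P\times Q$ no two distinct elements of which are contained in a common uniantichain; a uniantichain covering is a family of uniantichains whose union is $P\times Q$. If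 $P$ is $c$-decomposable and $d$-decomposable and $Q$ is $c$-decomposable, then the maximum size of a semichain of $P\times Q$ and the minimum size of a uniantichain covering of $P\times Q$ are equal, and their common value is $$\sum_{i=1}^{\min(w_P,w_Q)}\lambda^P_i\lambda^Q_i=\sum_{j=1}^{h(P)}c_{\mu^P_j}(Q).$$ -/

import Mathlib

namespace SaksWest

open Classical in
/-- The height `h(P)` of a finite poset: the largest size of a chain. -/
noncomputable def height (P : Type*) [PartialOrder P] [Fintype P] : ℕ :=
  (Finset.univ.filter fun S : Finset P => IsChain (· ≤ ·) (S : Set P)).sup Finset.card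

open Classical in
/-- The width `w(P)` of a finite poset: the largest size of an antichain. -/
noncomputable def width (P : Type*) [PartialOrder P] [Fintype P] : ℕ :=
  (Finset.univ.filter fun S : Finset P => IsAntichain (· ≤ ·) (S : Set P)).sup Finset.card

/-- A `k`-chain: a union of `k` pairwise disjoint (possibly empty) chains. -/
def IsKChain {P : Type*} [PartialOrder P] (k : ℕ) (S : Finset P) : Prop :=
  ∃ C : Fin k → Finset P,
    (∀ i, IsChain (· ≤ ·) (C i : Set P)) ∧
    (∀ i j, i ≠ j → Disjoint (C i) (C j)) ∧
    ∀ x, x ∈ S ↔ ∃ i, x ∈ C i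

/-- A `k`-antichain: a union of `k` pairwise disjoint (possibly empty) antichains. -/
def IsKAntichain {P : Type*} [PartialOrder P] (k : ℕ) (S : Finset P) : Prop :=
  ∃ A : Fin k → Finset P,
    (∀ i, IsAntichain (· ≤ ·) (A i : Set P)) ∧
    (∀ i j, i ≠ j → Disjoint (A i) (A j)) ∧
    ∀ x, x ∈ S ↔ ∃ i, x ∈ A i

open Classical in
/-- `c_k(P)`: the largest size of a `k`-chain of `P`. -/
noncomputable def cNum (P : Type*) [PartialOrder P] [Fintype P] (k : ℕ) : ℕ :=
  (Finset.univ.filter fun S : Finset P => IsKChain k S).sup Finset.card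

open Classical in
/-- `d_k(P)`: the largest size of a `k`-antichain of `P`. -/
noncomputable def dNum (P : Type*) [PartialOrder P] [Fintype P] (k : ℕ) : ℕ :=
  (Finset.univ.filter fun S : Finset P => IsKAntichain k S).sup Finset.card

/-- The `i`-th part (`i = 1, 2, …`) of the Greene partition `λ^P`, i.e. of the sequence
determined by `c_k(P) = λ_1 + … + λ_k` for all `k`; see `cNum_eq_sum_lam`. -/
noncomputable def lam (P : Type*) [PartialOrder P] [Fintype P] (i : ℕ) : ℕ :=
  cNum P i - cNum P (i - 1)

open Classical in
/-- The `j`-th part (`j = 1, 2, …`) of the partition `μ^P` conjugate to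
`λ^P = (λ_1, …, λ_{w(P)})`: the number of parts of `λ^P` that are at least `j`. -/
noncomputable def mu (P : Type*) [PartialOrder P] [Fintype P] (j : ℕ) : ℕ :=
  ((Finset.Icc 1 (width P)).filter fun i => j ≤ lam P i).card

open Classical in
/-- `P` is `c`-decomposable: it has a chain partition `C_1, …, C_w` with
`|C_1 ∪ … ∪ C_k| = c_k(P)` for each `k` (here the indices start at `0`). -/
def IsCDecomposable (P : Type*) [PartialOrder P] [Fintype P] : Prop :=
  ∃ C : Fin (width P) → Finset P,
    (∀ i, IsChain (· ≤ ·) (C i : Set P)) ∧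
    (∀ i j, i ≠ j → Disjoint (C i) (C j)) ∧
    (∀ x, ∃ i, x ∈ C i) ∧
    ∀ k : ℕ, ((Finset.univ.filter fun i : Fin (width P) => i.val < k).biUnion C).card = cNum P k

open Classical in
/-- `P` is `d`-decomposable: it has an antichain partition `A_1, …, A_h` with
`|A_1 ∪ … ∪ A_k| = d_k(P)` for each `k` (here the indices start at `0`). -/
def IsDDecomposable (P : Type*) [PartialOrder P] [Fintype P] : Prop :=
  ∃ A : Fin (height P) → Finset P,
    (∀ i, IsAntichain (· ≤ ·) (A i : Set P)) ∧
    (∀ i j, i ≠ j → Disjoint (A i) (A j)) ∧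
    (∀ x, ∃ i, x ∈ A i) ∧
    ∀ k : ℕ, ((Finset.univ.filter fun i : Fin (height P) => i.val < k).biUnion A).card = dNum P k

/-- A uniantichain of `P × Q`: an antichain in which one of the coordinates is fixed. -/
def IsUniantichain {P Q : Type*} [PartialOrder P] [PartialOrder Q] (U : Finset (P × Q)) : Prop :=
  IsAntichain (· ≤ ·) (U : Set (P × Q)) ∧
    ((∀ x ∈ U, ∀ y ∈ U, x.1 = y.1) ∨ (∀ x ∈ U, ∀ y ∈ U, x.2 = y.2))

/-- A semichain of `P × Q`: no two distinct elements lie in a common uniantichain. -/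
def IsSemichain {P Q : Type*} [PartialOrder P] [PartialOrder Q] (T : Finset (P × Q)) : Prop :=
  ∀ x ∈ T, ∀ y ∈ T, x ≠ y → ¬ ∃ U : Finset (P × Q), IsUniantichain U ∧ x ∈ U ∧ y ∈ U

/-- A uniantichain covering of `P × Q`: a family of uniantichains whose union is `P × Q`. -/
def IsUniantichainCovering {P Q : Type*} [PartialOrder P] [PartialOrder Q]
    (F : Finset (Finset (P × Q))) : Prop :=
  (∀ U ∈ F, IsUniantichain U) ∧ ∀ x : P × Q, ∃ U ∈ F, x ∈ U

theorem cNum_zero (P : Type*) [PartialOrder P] [Fintype P] : cNum P 0 = 0 := by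
  classical
  refine Nat.le_zero.mp (Finset.sup_le fun S hS => ?_)
  obtain ⟨C, -, -, h⟩ := (Finset.mem_filter.mp hS).2
  refine (Finset.card_eq_zero.mpr (Finset.eq_empty_of_forall_notMem fun x hx => ?_)).le
  obtain ⟨i, -⟩ := (h x).mp hx
  exact i.elim0

theorem cNum_le_succ (P : Type*) [PartialOrder P] [Fintype P] (k : ℕ) :
    cNum P k ≤ cNum P (k + 1) := by
  classical
  refine Finset.sup_mono fun S hS => ?_
  obtain ⟨C, h1, h2, h3⟩ := (Finset.mem_filter.mp hS).2
  refine Finset.mem_filter.mpr ⟨Finset.mem_univ _, Fin.cons ∅ C, ?_, ?_, ?_⟩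
  · intro i
    refine Fin.cases ?_ (fun i => ?_) i
    · simp
    · simpa using h1 i
  · intro i j
    refine Fin.cases ?_ (fun i => ?_) i
    · simp
    · refine Fin.cases ?_ (fun j => ?_) j
      · simp
      · intro hij
        simpa using h2 i j (fun h => hij (by rw [h]))
  · intro x
    rw [h3, Fin.exists_fin_succ]
    simp

/-- The parts `λ_i` do satisfy `c_k = λ_1 + … + λ_k`. -/
theorem cNum_eq_sum_lam (P : Type*) [PartialOrder P] [Fintype P] (k : ℕ) :
    cNum P k = ∑ i ∈ Finset.Icc 1 k, lam P i := by
  induction k with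
  | zero => simp [cNum_zero]
  | succ k ih =>
    rw [Finset.sum_Icc_succ_top (by omega), ← ih, lam, Nat.add_sub_cancel]
    have := cNum_le_succ P k
    omega

end SaksWest

/-!
A semichain meets every uniantichain at most once, so no semichain is larger than a uniantichain
covering, and it suffices to find one of each whose sizes are `∑ λ^P_i λ^Q_i`.

If `C_i` and `D_i` are the chains of `c`-decompositions of `P` and `Q`, then `⋃ C_i ×ˢ D_i` is a
semichain of this size (`exists_semichain`).

For the covering, take the antichains `A_j` of a `d`-decomposition of `P`. By Greene's theorem `Q`
has an antichain partition `𝒜` with `∑ B ∈ 𝒜, min k #B = c_k(Q)`. With `k = #A_j`, this covers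
`A_j ×ˢ Q` by `c_k(Q)` uniantichains, as `A_j ×ˢ B` is covered by `#A_j` copies of `B` as well as by
`#B` copies of `A_j` (`exists_uniantichains_covering_product`). Greene's theorem for `P` also shows
that the sizes of the `A_j` form the partition conjugate to `λ^P`
(`IsDDecomposable.exists_antichains`), and double counting turns the total `∑ c_{#A_j}(Q)` into
`∑ λ^P_i λ^Q_i`.

The part of Greene's theorem that is needed is `exists_antichains_card_add_mul_le`. It is obtained
from the duality theorem for the assignment problem (`exists_perm_potentials`) on `P` with `k` points
added, where leaving an element of `P` fixed costs `1`, moving it upwards or to and from an added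
point is free, and other moves are prohibitive. The orbits of a cheap permutation give `k` chains
(`card_moved_le_cNum`), and the level sets of the optimal potentials give the antichains.
-/

namespace SaksWest

open Finset

/-! ### Duality for the assignment problem -/

/-- Egerváry's theorem: an integer cost matrix has a permutation and integer potentials that are
tight along it. Potentials of maximal total value do: a set violating Hall's condition in the graph
of tight entries would allow a shift of the potentials that increases the total. -/
theorem exists_perm_potentials {V : Type*} [Fintype V] (c : V → V → ℤ) :
    ∃ (u v : V → ℤ) (σ : Equiv.Perm V),
      (∀ i j, u i + v j ≤ c i j) ∧ ∀ i, u i + v (σ i) = c i (σ i) := by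
  classical
  obtain ⟨m, ⟨u, v, huv, hm⟩, hmax⟩ := Int.exists_greatest_of_bdd
    (P := fun z => ∃ u v : V → ℤ, (∀ i j, u i + v j ≤ c i j) ∧ ∑ i, (u i + v i) = z)
    ⟨∑ i, c i i, by
      rintro z ⟨u, v, huv, rfl⟩
      exact sum_le_sum fun i _ => huv i i⟩
    ⟨_, fun i => -∑ j, |c i j|, fun _ => 0, fun i j => by
      have := single_le_sum (fun j _ => abs_nonneg (c i j)) (mem_univ j)
      have := neg_abs_le (c i j)
      linarith, rfl⟩
  let N : V → Finset V := fun i => univ.filter fun j => u i + v j = c i j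
  have hall : ∀ s : Finset V, #s ≤ #(s.biUnion N) := by
    intro s
    by_contra! hlt
    have := hmax _ ⟨fun i => u i + if i ∈ s then 1 else 0,
      fun j => v j - if j ∈ s.biUnion N then 1 else 0, fun i j => by
        have h := huv i j
        by_cases hi : i ∈ s
        · by_cases hj : j ∈ s.biUnion N
          · simp only [hi, hj, if_true]; linarith
          · have : u i + v j ≠ c i j := fun h' =>
              hj (mem_biUnion.mpr ⟨i, hi, by simp [N, h']⟩)
            simp only [hi, hj, if_true, if_false]; omega
        · simp only [hi, if_false]; split_ifs <;> omega, rfl⟩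
    have e : ∑ i, ((u i + if i ∈ s then 1 else 0) + (v i - if i ∈ s.biUnion N then 1 else 0))
        = m + #s - #(s.biUnion N) := by
      rw [← hm]
      simp only [sum_add_distrib, sum_sub_distrib, sum_boole, filter_univ_mem]
      ring
    rw [e] at this
    omega
  obtain ⟨f, hinj, hf⟩ := (Finset.all_card_le_biUnion_card_iff_exists_injective N).mp hall
  exact ⟨u, v, Equiv.ofBijective f (Finite.injective_iff_bijective.mp hinj), huv,
    fun i => by simpa [N] using hf i⟩

/-! ### Families of chains and antichains -/

theorem card_inter_le_one {P : Type*} [PartialOrder P] [DecidableEq P]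
    {C A : Finset P} (hC : IsChain (· ≤ ·) (C : Set P)) (hA : IsAntichain (· ≤ ·) (A : Set P)) : #(C ∩ A) ≤ 1 := by
  refine card_le_one.mpr fun x hx y hy => ?_
  rw [mem_inter] at hx hy
  rcases hC.total hx.1 hy.1 with h | h
  · exact hA.eq hx.2 hy.2 h
  · exact (hA.eq hy.2 hx.2 h).symm

section Families

variable {P : Type*} [PartialOrder P] [Fintype P]

theorem IsKChain.card_le {k : ℕ} {S : Finset P} (h : IsKChain k S) : #S ≤ cNum P k := by
  classical exact le_sup (f := card) (mem_filter.mpr ⟨mem_univ _, h⟩)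

theorem IsKAntichain.card_le {k : ℕ} {S : Finset P} (h : IsKAntichain k S) : #S ≤ dNum P k := by
  classical exact le_sup (f := card) (mem_filter.mpr ⟨mem_univ _, h⟩)

theorem card_le_height {S : Finset P} (h : IsChain (· ≤ ·) (S : Set P)) : #S ≤ height P := by
  classical exact le_sup (f := card) (mem_filter.mpr ⟨mem_univ _, h⟩)

theorem card_le_width {S : Finset P} (h : IsAntichain (· ≤ ·) (S : Set P)) : #S ≤ width P := by
  classical exact le_sup (f := card) (mem_filter.mpr ⟨mem_univ _, h⟩)

theorem card_biUnion_le_cNum [DecidableEq P] {ι : Type*} {C : ι → Finset P}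
    (hC : ∀ i, IsChain (· ≤ ·) (C i : Set P)) (hd : ∀ i j, i ≠ j → Disjoint (C i) (C j))
    (s : Finset ι) : #(s.biUnion C) ≤ cNum P #s := by
  refine IsKChain.card_le ⟨fun i => C (s.equivFin.symm i), fun i => hC _, fun i j hij => ?_,
    fun x => ?_⟩
  · exact hd _ _ fun h => hij (s.equivFin.symm.injective (Subtype.ext h))
  · rw [mem_biUnion]
    constructor
    · rintro ⟨i, hi, hx⟩
      exact ⟨s.equivFin ⟨i, hi⟩, by simpa using hx⟩
    · rintro ⟨i, hx⟩
      exact ⟨_, (s.equivFin.symm i).2, hx⟩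

/-- A permutation of `P` together with `k` extra points that moves each element of `P` upwards,
fixes it or sends it to an extra point has its non-fixed elements of `P` arranged in `k` chains:
the chain of an extra point consists of the elements whose orbit meets that point first. -/
theorem card_moved_le_cNum {k : ℕ} (σ : Equiv.Perm (P ⊕ Fin k))
    (hσ : ∀ x y, σ (.inl x) = .inl y → x ≤ y) [DecidablePred fun x : P => σ (.inl x) ≠ .inl x] :
    #(univ.filter fun x : P => σ (.inl x) ≠ .inl x) ≤ cNum P k := by
  classical
  have up : ∀ (d : ℕ) (x y : P), (∀ i < d, ∃ z, (σ ^ i) (.inl x) = .inl z) →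
      (σ ^ d) (.inl x) = .inl y → x ≤ y := by
    intro d
    induction d with
    | zero => intro x y _ h; simpa using (Sum.inl_injective h).le
    | succ d ih =>
      intro x y h1 h2
      obtain ⟨z, hz⟩ := h1 d (by omega)
      rw [pow_succ', Equiv.Perm.mul_apply, hz] at h2
      exact (ih x z (fun i hi => h1 i (by omega)) hz).trans (hσ z y h2)
  let hit : P → Fin k → ℕ → Prop := fun x t m =>
    (σ ^ m) (.inl x) = .inr t ∧ ∀ i < m, ∃ z, (σ ^ i) (.inl x) = .inl z
  have hit_total : ∀ x y t m d, hit x t m → hit y t (m + d) → y ≤ x := by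
    rintro x y t m d ⟨hx, -⟩ ⟨hy, hy'⟩
    rw [pow_add, Equiv.Perm.mul_apply, ← hx] at hy
    exact up d y x (fun i hi => hy' i (by
      by_contra hcon
      have : m = 0 := by omega
      subst this
      simp at hx)) ((σ ^ m).injective hy)
  have hit_unique : ∀ x t t' m m', hit x t m → hit x t' m' → t = t' := by
    rintro x t t' m m' ⟨h1, h2⟩ ⟨h3, h4⟩
    rcases lt_trichotomy m m' with h | h | h
    · obtain ⟨z, hz⟩ := h4 m h; rw [h1] at hz; cases hz
    · subst h; rw [h1] at h3; exact Sum.inr_injective h3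
    · obtain ⟨z, hz⟩ := h2 m' h; rw [h3] at hz; cases hz
  have hit_exists : ∀ x, σ (.inl x) ≠ .inl x → ∃ t m, hit x t m := by
    intro x hx
    by_cases hex : ∃ m t, (σ ^ m) (.inl x) = .inr t
    · obtain ⟨t, ht⟩ := Nat.find_spec hex
      refine ⟨t, Nat.find hex, ht, fun i hi => ?_⟩
      have := Nat.find_min hex hi
      rcases h : (σ ^ i) (.inl x) with z | t
      · exact ⟨z, rfl⟩
      · exact absurd ⟨t, h⟩ this
    · exfalso
      have all : ∀ m, ∃ z, (σ ^ m) (.inl x) = .inl z := by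
        intro m
        rcases h : (σ ^ m) (.inl x) with z | t
        · exact ⟨z, rfl⟩
        · exact absurd ⟨m, t, h⟩ hex
      obtain ⟨y, hy⟩ := all 1
      rw [pow_one] at hy
      have hxy := hσ x y hy
      -- The orbit is finite, so it climbs back from `y = σ x` to `x`.
      have hyx : y ≤ x := by
        refine up (orderOf σ - 1) y x (fun i _ => ?_) ?_
        · rw [← hy, ← Equiv.Perm.mul_apply, ← pow_succ]; exact all _
        · rw [← hy, ← Equiv.Perm.mul_apply, ← pow_succ, Nat.sub_add_cancel (orderOf_pos σ),
            pow_orderOf_eq_one]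
          rfl
      exact hx (by rw [hy, le_antisymm hxy hyx])
  calc #(univ.filter fun x : P => σ (.inl x) ≠ .inl x)
      ≤ #(univ.biUnion fun t => univ.filter fun x => ∃ m, hit x t m) := by
        refine card_le_card fun x hx => ?_
        simpa using hit_exists x (by simpa using hx)
    _ ≤ cNum P #(univ : Finset (Fin k)) := by
        refine card_biUnion_le_cNum (fun t => ?_) (fun t t' htt => ?_) _
        · intro x hx y hy _
          obtain ⟨m, hm⟩ : ∃ m, hit x t m := by simpa using hx
          obtain ⟨m', hm'⟩ : ∃ m, hit y t m := by simpa using hy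
          rcases le_total m m' with h | h
          · obtain ⟨d, rfl⟩ := Nat.exists_eq_add_of_le h
            exact Or.inr (hit_total x y t m d hm hm')
          · obtain ⟨d, rfl⟩ := Nat.exists_eq_add_of_le h
            exact Or.inl (hit_total y x t m' d hm' hm)
        · refine disjoint_left.mpr fun x hx hx' => ?_
          obtain ⟨m, hm⟩ : ∃ m, hit x t m := by simpa using hx
          obtain ⟨m', hm'⟩ : ∃ m, hit x t' m := by simpa using hx'
          exact htt (hit_unique x t t' m m' hm hm')
    _ = cNum P k := by simp

/-! ### Greene's theorem for `k`-chains -/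

open Classical in
/-- The nontrivial inequality of Greene's theorem: completing the antichains `A j` by singletons to
an antichain partition `𝒜`, it says that `∑ B ∈ 𝒜, min k #B ≤ c_k`. -/
theorem exists_antichains_card_add_mul_le (P : Type*) [PartialOrder P] [Fintype P] (k : ℕ) :
    ∃ (l : ℕ) (A : Fin l → Finset P), (∀ j, IsAntichain (· ≤ ·) (A j : Set P)) ∧
      (∀ i j, i ≠ j → Disjoint (A i) (A j)) ∧
      Fintype.card P + k * l ≤ cNum P k + #(univ.biUnion A) := by
  -- Entries with `x ≰ y` are so expensive that no permutation as cheap as the identity uses them.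
  let c : P ⊕ Fin k → P ⊕ Fin k → ℤ
    | .inl x, .inl y => if x = y then 1 else if x < y then 0 else Fintype.card P + 1
    | _, _ => 0
  obtain ⟨u, v, σ, huv, hσ⟩ := exists_perm_potentials c
  have c_nonneg : ∀ i j, 0 ≤ c i j := by
    rintro (x | t) (y | t') <;> simp only [c, le_refl]
    split_ifs <;> positivity
  have cost : ∑ i, c i (σ i) = ∑ i, (u i + v i) := by
    rw [sum_add_distrib, ← Equiv.sum_comp σ v, ← sum_add_distrib]
    exact sum_congr rfl fun i _ => (hσ i).symm
  have cost_le : ∑ i, c i (σ i) ≤ Fintype.card P := by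
    rw [cost]
    calc ∑ i, (u i + v i) ≤ ∑ i, c i i := sum_le_sum fun i _ => huv i i
      _ = Fintype.card P := by simp [c]
  have mono : ∀ x y, σ (.inl x) = .inl y → x ≤ y := by
    intro x y hxy
    by_contra hle
    have h1 := single_le_sum (fun i _ => c_nonneg i (σ i)) (mem_univ (Sum.inl x))
    have h2 : c (.inl x) (σ (.inl x)) = Fintype.card P + 1 := by
      rw [hxy]
      simp only [c]
      rw [if_neg fun h => hle h.le, if_neg fun h => hle h.le]
    rw [h2] at h1
    omega
  have fixed : (#(univ.filter fun x : P => σ (.inl x) = .inl x) : ℤ) = ∑ i, c i (σ i) := by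
    rw [Fintype.sum_sum_type, card_filter]
    push_cast
    have : ∑ t : Fin k, c (.inr t) (σ (.inr t)) = 0 := sum_eq_zero fun t _ => by simp [c]
    rw [this, add_zero]
    refine sum_congr rfl fun x _ => ?_
    rcases h : σ (.inl x) with y | t
    · have hxy := mono x y h
      rcases hxy.eq_or_lt with rfl | hlt
      · simp [c]
      · simp [c, hlt, hlt.ne, hlt.ne']
    · simp [c]
  have moved := card_moved_le_cNum σ mono
  have split := card_filter_add_card_filter_not (s := (univ : Finset P))
    (fun x : P => σ (.inl x) = .inl x)
  rw [card_univ] at split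
  by_cases hfix : ∃ x : P, σ (.inl x) = .inl x
  swap
  · refine ⟨0, fun j => j.elim0, fun j => j.elim0, fun j => j.elim0, ?_⟩
    have : #(univ.filter fun x : P => σ (.inl x) = .inl x) = 0 := by
      simpa [filter_eq_empty_iff] using hfix
    simp only [ne_eq] at moved
    omega
  obtain ⟨x₀, hx₀⟩ := hfix
  have gap : ∀ x : P, u (.inl x) ≤ -v (.inl x) + 1 := by
    intro x
    have := huv (.inl x) (.inl x)
    simp only [c, if_true] at this
    linarith
  have gap₀ : u (.inl x₀) = -v (.inl x₀) + 1 := by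
    have := hσ (.inl x₀)
    rw [hx₀] at this
    simp only [c, if_true] at this
    linarith
  have step : ∀ x y : P, x < y → u (.inl x) ≤ -v (.inl y) := by
    intro x y hxy
    have := huv (.inl x) (.inl y)
    simp only [c, hxy.ne, hxy, if_true, if_false] at this
    linarith
  have lower : ∀ (t : Fin k) (x : P), u (.inr t) ≤ -v (.inl x) := fun t x => by
    have := huv (.inr t) (.inl x)
    simp only [c] at this
    linarith
  have upper : ∀ (t : Fin k) (x : P), u (.inl x) ≤ -v (.inr t) := fun t x => by
    have := huv (.inl x) (.inr t)
    simp only [c] at this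
    linarith
  -- The fixed point `x₀` forces `u t < -v t'` for all extra points `t` and `t'`, so `σ` never sends
  -- one extra point to another; tightness along `σ` then makes `u` and `v` constant on them.
  have no_token : ∀ t t', σ (.inr t) ≠ .inr t' := by
    intro t t' h
    have h1 := hσ (.inr t)
    rw [h] at h1
    simp only [c] at h1
    have := lower t x₀
    have := upper t' x₀
    linarith
  have u_const : ∀ t t', u (.inr t) ≤ u (.inr t') := by
    intro t t'
    rcases h : σ (.inr t') with y | s
    · have h1 := hσ (.inr t')
      rw [h] at h1
      simp only [c] at h1
      have := lower t y
      linarith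
    · exact absurd h (no_token _ _)
  have v_const : ∀ t t', v (.inr t) ≤ v (.inr t') := by
    intro t t'
    rcases h : σ.symm (.inr t') with y | s
    · have h2 : σ (.inl y) = .inr t' := by rw [← h, σ.apply_symm_apply]
      have h1 := hσ (.inl y)
      rw [h2] at h1
      simp only [c] at h1
      have := upper t y
      linarith
    · exact absurd (by rw [← h, σ.apply_symm_apply]) (no_token s t')
  rcases Nat.eq_zero_or_pos k with rfl | hk
  · refine ⟨Fintype.card P, fun j => {(Fintype.equivFin P).symm j}, fun j => by simp,
      fun i j hij => by simpa using hij, ?_⟩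
    have : (univ.biUnion fun j => {(Fintype.equivFin P).symm j}) = (univ : Finset P) := by
      ext x
      simp only [mem_biUnion, mem_univ, true_and, mem_singleton, iff_true]
      exact ⟨Fintype.equivFin P x, by simp⟩
    rw [this, card_univ]
    omega
  let t₀ : Fin k := ⟨0, hk⟩
  obtain ⟨l, hl⟩ : ∃ l : ℕ, (l : ℤ) = -v (.inr t₀) - u (.inr t₀) :=
    ⟨(-v (.inr t₀) - u (.inr t₀)).toNat, Int.toNat_of_nonneg (by
      have := lower t₀ x₀
      have := upper t₀ x₀
      linarith)⟩
  refine ⟨l, fun j => univ.filter fun x =>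
    u (.inl x) = -v (.inl x) + 1 ∧ u (.inl x) = u (.inr t₀) + 1 + (j : ℕ), ?_, ?_, ?_⟩
  · intro j x hx y hy hne hle
    simp only [coe_filter, mem_univ, true_and, Set.mem_ofPred_eq] at hx hy
    have := step x y (lt_of_le_of_ne hle hne)
    linarith
  · intro i j hij
    refine disjoint_left.mpr fun x hx hy => hij (Fin.ext ?_)
    simp only [mem_filter, mem_univ, true_and] at hx hy
    omega
  · have hU : (univ.filter fun x : P => u (.inl x) = -v (.inl x) + 1) ⊆
        univ.biUnion fun j : Fin l => univ.filter fun x : P =>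
          u (.inl x) = -v (.inl x) + 1 ∧ u (.inl x) = u (.inr t₀) + 1 + (j : ℕ) := by
      intro x hx
      simp only [mem_filter, mem_univ, true_and, mem_biUnion] at hx ⊢
      have h1 := lower t₀ x
      have h2 := upper t₀ x
      exact ⟨⟨(u (.inl x) - u (.inr t₀) - 1).toNat, by omega⟩, hx, by simp only; omega⟩
    have hle := card_le_card hU
    have count : ∑ x : P, (u (.inl x) + v (.inl x)) ≤
        (#(univ.filter fun x : P => u (.inl x) = -v (.inl x) + 1) : ℤ) := by
      rw [card_filter]
      push_cast
      refine sum_le_sum fun x _ => ?_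
      have := gap x
      split_ifs <;> omega
    have tokens : ∑ t : Fin k, (u (.inr t) + v (.inr t)) = -(k * l : ℤ) := by
      rw [sum_congr rfl fun t _ => show u (.inr t) + v (.inr t) = -(l : ℤ) by
        rw [hl, le_antisymm (u_const t t₀) (u_const t₀ t),
          le_antisymm (v_const t t₀) (v_const t₀ t)]
        ring]
      simp
    rw [cost, Fintype.sum_sum_type, tokens] at fixed
    simp only [ne_eq] at moved
    zify at hle moved split ⊢
    linarith

end Families

/-! ### Greene partitions of decomposable posets -/

open Classical in
theorem card_biUnion_lt_succ {P : Type*} {w : ℕ} {C : Fin w → Finset P}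
    (hd : ∀ i j, i ≠ j → Disjoint (C i) (C j)) (i : Fin w) :
    #((univ.filter fun j : Fin w => j.val < i + 1).biUnion C) =
      #((univ.filter fun j : Fin w => j.val < i).biUnion C) + #(C i) := by
  have h : (univ.filter fun j : Fin w => j.val < i + 1) =
      insert i (univ.filter fun j : Fin w => j.val < i) := by
    ext j
    simp only [mem_filter, mem_univ, true_and, mem_insert, Fin.ext_iff]
    omega
  rw [h, biUnion_insert, card_union_of_disjoint, add_comm]
  refine (disjoint_biUnion_right _ _ _).mpr fun j hj => hd i j ?_
  rintro rfl
  simp at hj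

section Decomposable

variable {P : Type*} [PartialOrder P] [Fintype P]

theorem cNum_succ (k : ℕ) : cNum P (k + 1) = cNum P k + lam P (k + 1) := by
  have := cNum_le_succ P k
  rw [lam, Nat.add_sub_cancel]
  omega

/-- The data of a `c`-decomposition, with the sizes of its chains read off. -/
theorem IsCDecomposable.exists_chains (h : IsCDecomposable P) :
    ∃ C : Fin (width P) → Finset P,
      (∀ i, IsChain (· ≤ ·) (C i : Set P)) ∧ (∀ i j, i ≠ j → Disjoint (C i) (C j)) ∧
      ∀ i, #(C i) = lam P (i + 1) := by
  classical
  obtain ⟨C, hC, hd, -, hk⟩ := h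
  refine ⟨C, hC, hd, fun i => ?_⟩
  have h1 := card_biUnion_lt_succ hd i
  have h2 := hk (i + 1)
  have h3 := hk i
  have h4 := cNum_succ (P := P) i
  simp only [← h2, ← h3] at h4
  convert Nat.add_left_cancel (h1.symm.trans ?_) using 1
  convert h4

theorem IsCDecomposable.lam_eq_zero (h : IsCDecomposable P) {i : ℕ} (hi : width P < i) :
    lam P i = 0 := by
  classical
  obtain ⟨C, -, -, -, hk⟩ := h
  have all : ∀ k, width P ≤ k → cNum P k = #(univ.biUnion C) := by
    intro k hwk
    rw [← hk k, filter_true_of_mem fun i _ => i.2.trans_le hwk]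
  rw [lam, all i hi.le, all (i - 1) (by omega), Nat.sub_self]

theorem IsCDecomposable.lam_le_height (h : IsCDecomposable P) {i : ℕ} (hi : 1 ≤ i) :
    lam P i ≤ height P := by
  rcases lt_or_ge (width P) i with hw | hw
  · simp [h.lam_eq_zero hw]
  obtain ⟨C, hC, -, hcard⟩ := h.exists_chains
  have := card_le_height (hC ⟨i - 1, by omega⟩)
  rwa [hcard, Nat.sub_add_cancel hi] at this

/-- Exchanging the `i`-th chain of a `c`-decomposition for the next one gives an `i`-chain. -/
theorem IsCDecomposable.lam_succ_le (h : IsCDecomposable P) {i : ℕ} (hi : 1 ≤ i) :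
    lam P (i + 1) ≤ lam P i := by
  classical
  rcases lt_or_ge (width P) (i + 1) with hw | hw
  · simp [h.lam_eq_zero hw]
  obtain ⟨C, hC, hd, hcard⟩ := h.exists_chains
  let s : Finset (Fin (width P)) := univ.filter fun j => j.val < i - 1
  let b : Fin (width P) := ⟨i, by omega⟩
  have hb : b ∉ s := by simp only [s, b, mem_filter, mem_univ, true_and]; omega
  have hs : #s = i - 1 := by
    simp only [s, Fin.card_filter_val_lt]
    omega
  have h1 := card_biUnion_le_cNum hC hd (insert b s)
  rw [card_insert_of_notMem hb, hs, Nat.sub_add_cancel hi, card_biUnion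
    (fun x _ y _ hxy => hd x y hxy), sum_insert hb, hcard] at h1
  have h2 : ∑ j ∈ s, #(C j) = cNum P (i - 1) := by
    rw [cNum_eq_sum_lam]
    refine sum_bij (fun j _ => j.val + 1) ?_ ?_ ?_ ?_
    · intro j hj
      simp only [s, mem_filter, mem_univ, true_and] at hj
      exact mem_Icc.mpr ⟨by omega, by omega⟩
    · intro a _ b _ hab
      exact Fin.ext (by omega)
    · intro m hm
      rw [mem_Icc] at hm
      exact ⟨⟨m - 1, by omega⟩, by simp only [s, mem_filter, mem_univ, true_and]; omega,
        by simp only; omega⟩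
    · intro j _
      exact hcard j
  have h3 := cNum_succ (P := P) (i - 1)
  rw [Nat.sub_add_cancel hi] at h3
  have hbv : lam P (b.val + 1) = lam P (i + 1) := rfl
  omega

theorem IsCDecomposable.lam_anti (h : IsCDecomposable P) {i j : ℕ} (hi : 1 ≤ i) (hij : i ≤ j) :
    lam P j ≤ lam P i := by
  induction j, hij using Nat.le_induction with
  | base => exact le_rfl
  | succ j hj ih => exact (h.lam_succ_le (hi.trans hj)).trans ih

/-- As `λ^P` is weakly decreasing, the parts of size at least `j` are the first `μ^P_j` ones. -/
theorem IsCDecomposable.le_lam_iff (h : IsCDecomposable P) {i j : ℕ} (hi : i ∈ Icc 1 (width P)) :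
    j ≤ lam P i ↔ i ≤ mu P j := by
  classical
  rw [mem_Icc] at hi
  constructor
  · intro hj
    calc i = #(Icc 1 i) := by simp
      _ ≤ mu P j := card_le_card fun a ha => by
        rw [mem_Icc] at ha
        exact mem_filter.mpr ⟨mem_Icc.mpr ⟨ha.1, ha.2.trans hi.2⟩, hj.trans (h.lam_anti ha.1 ha.2)⟩
  · intro hj
    by_contra hlt
    have : mu P j ≤ #(Icc 1 (i - 1)) := card_le_card fun a ha => by
      rw [mem_filter, mem_Icc] at ha
      rw [mem_Icc]
      refine ⟨ha.1.1, ?_⟩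
      by_contra hcon
      exact hlt (ha.2.trans (h.lam_anti hi.1 (by omega)))
    rw [Nat.card_Icc] at this
    omega

/-- Double counting of the pairs `(i, j)` with `i ≤ a j`. -/
theorem sum_cNum_eq {ι : Type*} (Q : Type*) [PartialOrder Q] [Fintype Q] (s : Finset ι)
    (a : ι → ℕ) {w : ℕ} (ha : ∀ j ∈ s, a j ≤ w) :
    ∑ j ∈ s, cNum Q (a j) = ∑ i ∈ Icc 1 w, #(s.filter fun j => i ≤ a j) * lam Q i := by
  simp_rw [card_filter, sum_mul, boole_mul]
  rw [sum_comm]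
  refine sum_congr rfl fun j hj => ?_
  rw [cNum_eq_sum_lam, ← sum_filter]
  refine sum_congr ?_ fun _ _ => rfl
  ext i
  have := ha j hj
  simp only [mem_Icc, mem_filter]
  omega

theorem sum_lam_mul_lam {Q : Type*} [PartialOrder Q] [Fintype Q] (hQ : IsCDecomposable Q) :
    ∑ i ∈ Icc 1 (width P), lam P i * lam Q i =
      ∑ i ∈ Icc 1 (min (width P) (width Q)), lam P i * lam Q i := by
  refine (sum_subset (Icc_subset_Icc le_rfl (min_le_left _ _)) fun i hi hi' => ?_).symm
  rw [mem_Icc] at hi hi'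
  rw [hQ.lam_eq_zero (by omega), mul_zero]

theorem sum_lam_mul_lam_eq_sum_cNum_mu {Q : Type*} [PartialOrder Q] [Fintype Q]
    (hP : IsCDecomposable P) :
    ∑ i ∈ Icc 1 (width P), lam P i * lam Q i = ∑ j ∈ Icc 1 (height P), cNum Q (mu P j) := by
  classical
  rw [sum_cNum_eq Q (Icc 1 (height P)) (mu P) (w := width P) fun j _ =>
    (card_filter_le _ _).trans (by simp)]
  refine sum_congr rfl fun i hi => ?_
  congr 1
  have := hP.lam_le_height (mem_Icc.mp hi).1
  have e : ((Icc 1 (height P)).filter fun j => i ≤ mu P j) = Icc 1 (lam P i) := by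
    ext j
    rw [mem_filter, ← hP.le_lam_iff hi, mem_Icc, mem_Icc]
    omega
  rw [e, Nat.card_Icc, Nat.add_sub_cancel]

/-- A `d`-decomposition attains equality in Greene's theorem for every `k` simultaneously, so the
sizes of its antichains form the partition conjugate to `λ^P`. -/
theorem IsDDecomposable.exists_antichains (hd : IsDDecomposable P) :
    ∃ A : Fin (height P) → Finset P,
      (∀ j, IsAntichain (· ≤ ·) (A j : Set P)) ∧ (∀ x, ∃ j, x ∈ A j) ∧
      ∀ i, 1 ≤ i → #(univ.filter fun j => i ≤ #(A j)) = lam P i := by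
  classical
  obtain ⟨A, hA, hdis, hcov, hcard⟩ := hd
  refine ⟨A, hA, hcov, ?_⟩
  have hn : ∑ j, #(A j) = Fintype.card P := by
    rw [← card_biUnion fun x _ y _ hxy => hdis x y hxy, ← card_univ]
    congr 1
    ext x
    simpa using hcov x
  have lower : ∀ k, cNum P k ≤ ∑ j, min k #(A j) := by
    intro k
    refine Finset.sup_le fun S hS => ?_
    obtain ⟨C, hC, -, hSC⟩ := (mem_filter.mp hS).2
    have hS' : S = univ.biUnion fun j => S ∩ A j := by
      ext x
      simp [hcov x]
    rw [hS']
    refine card_biUnion_le.trans (sum_le_sum fun j _ => le_min ?_ (card_le_card inter_subset_right))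
    calc #(S ∩ A j) ≤ #((univ : Finset (Fin k)).biUnion fun i => C i ∩ A j) := by
          refine card_le_card fun x hx => ?_
          rw [mem_inter, hSC] at hx
          obtain ⟨⟨i, hi⟩, hx⟩ := hx
          exact mem_biUnion.mpr ⟨i, mem_univ _, mem_inter.mpr ⟨hi, hx⟩⟩
      _ ≤ #(univ : Finset (Fin k)) * 1 :=
          card_biUnion_le_card_mul _ _ _ fun i _ => card_inter_le_one (hC i) (hA j)
      _ = k := by simp
  have upper : ∀ k, ∑ j, min k #(A j) ≤ cNum P k := by
    intro k
    obtain ⟨l, B, hB, hBd, hle⟩ := exists_antichains_card_add_mul_le P k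
    have hdl : #(univ.biUnion B) ≤ dNum P l :=
      IsKAntichain.card_le ⟨B, hB, hBd, fun x => by simp⟩
    rw [← hcard l, card_biUnion fun x _ y _ hxy => hdis x y hxy] at hdl
    have h1 : ∑ j with j.val < l, min k #(A j) ≤ k * l := by
      calc ∑ j with j.val < l, min k #(A j)
          ≤ #(univ.filter fun j : Fin (height P) => j.val < l) * k := by
            rw [← smul_eq_mul]
            exact sum_le_card_nsmul _ _ _ fun j _ => min_le_left _ _
        _ ≤ l * k := by
            refine Nat.mul_le_mul_right k ?_
            rw [Fin.card_filter_val_lt]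
            exact min_le_right _ _
        _ = k * l := mul_comm _ _
    have h2 : ∑ j with ¬ j.val < l, min k #(A j) ≤
        ∑ j : Fin (height P) with ¬ j.val < l, #(A j) := sum_le_sum fun j _ => min_le_right _ _
    have h3 := sum_filter_add_sum_filter_not univ (fun j : Fin (height P) => j.val < l)
      fun j => #(A j)
    have h4 := sum_filter_add_sum_filter_not univ (fun j : Fin (height P) => j.val < l)
      fun j => min k #(A j)
    omega
  intro i hi
  have h1 := le_antisymm (lower i) (upper i)
  have h2 := le_antisymm (lower (i - 1)) (upper (i - 1))
  rw [lam, h1, h2]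
  refine Nat.eq_sub_of_add_eq' ?_
  rw [card_filter, ← sum_add_distrib]
  refine sum_congr rfl fun j _ => ?_
  split_ifs <;> omega

end Decomposable

/-! ### Semichains and uniantichain coverings -/

section Product

variable {P Q : Type*} [PartialOrder P] [PartialOrder Q]

theorem IsSemichain.card_le_card {T : Finset (P × Q)} {F : Finset (Finset (P × Q))}
    (hT : IsSemichain T) (hF : IsUniantichainCovering F) : #T ≤ #F := by
  choose U hUF hU using hF.2
  refine card_le_card_of_injOn U (fun x _ => hUF x) fun x hx y hy hxy => ?_
  by_contra hne
  exact hT x hx y hy hne ⟨U x, hF.1 _ (hUF x), hU x, hxy ▸ hU y⟩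

theorem isUniantichain_singleton_product (p : P) {B : Finset Q}
    (hB : IsAntichain (· ≤ ·) (B : Set Q)) : IsUniantichain ({p} ×ˢ B) := by
  refine ⟨fun x hx y hy hne hle => ?_, Or.inl fun x hx y hy => ?_⟩
  all_goals
    simp only [coe_product, coe_singleton, Set.mem_prod, Set.mem_singleton_iff, mem_coe,
      mem_product, mem_singleton] at hx hy
  · exact hne (Prod.ext (hx.1.trans hy.1.symm) (hB.eq hx.2 hy.2 hle.2))
  · exact hx.1.trans hy.1.symm

theorem isUniantichain_product_singleton {A : Finset P}
    (hA : IsAntichain (· ≤ ·) (A : Set P)) (q : Q) : IsUniantichain (A ×ˢ {q}) := by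
  refine ⟨fun x hx y hy hne hle => ?_, Or.inr fun x hx y hy => ?_⟩
  all_goals
    simp only [coe_product, coe_singleton, Set.mem_prod, Set.mem_singleton_iff, mem_coe,
      mem_product, mem_singleton] at hx hy
  · exact hne (Prod.ext (hA.eq hx.1 hy.1 hle.1) (hx.2.trans hy.2.symm))
  · exact hx.2.trans hy.2.symm

/-- Products of corresponding chains form a semichain: two of its elements with a common first
coordinate have their second coordinates in the same chain, and vice versa. -/
theorem isSemichain_biUnion_product [DecidableEq P] [DecidableEq Q] {ι : Type*} {s : Finset ι}
    {C : ι → Finset P} {D : ι → Finset Q}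
    (hC : ∀ i ∈ s, IsChain (· ≤ ·) (C i : Set P)) (hD : ∀ i ∈ s, IsChain (· ≤ ·) (D i : Set Q))
    (hCd : (s : Set ι).PairwiseDisjoint C) (hDd : (s : Set ι).PairwiseDisjoint D) :
    IsSemichain (s.biUnion fun i => C i ×ˢ D i) := by
  rintro ⟨p, q⟩ hx ⟨p', q'⟩ hy hne ⟨U, ⟨hU, hconst⟩, hxU, hyU⟩
  simp only [mem_biUnion, mem_product] at hx hy
  obtain ⟨i, hi, hp, hq⟩ := hx
  obtain ⟨j, hj, hp', hq'⟩ := hy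
  have not_le := hU hxU hyU hne
  have not_ge := hU hyU hxU hne.symm
  rcases hconst with h | h
  · obtain rfl : p = p' := h _ hxU _ hyU
    obtain rfl : i = j := hCd.elim_finset hi hj p hp hp'
    rcases (hD i hi).total hq hq' with hle | hle
    · exact not_le ⟨le_rfl, hle⟩
    · exact not_ge ⟨le_rfl, hle⟩
  · obtain rfl : q = q' := h _ hxU _ hyU
    obtain rfl : i = j := hDd.elim_finset hi hj q hq hq'
    rcases (hC i hi).total hp hp' with hle | hle
    · exact not_le ⟨hle, le_rfl⟩
    · exact not_ge ⟨hle, le_rfl⟩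

variable [Fintype Q]

/-- If `A` is an antichain of size `k`, then `A ×ˢ Q` is covered by `c_k(Q)` uniantichains: over each
block `B` of an antichain partition of `Q` that attains Greene's bound, one uses either the sets
`{p} ×ˢ B` or the sets `A ×ˢ {q}`. -/
theorem exists_uniantichains_covering_product {A : Finset P}
    (hA : IsAntichain (· ≤ ·) (A : Set P)) :
    ∃ F : Finset (Finset (P × Q)), (∀ U ∈ F, IsUniantichain U) ∧
      (∀ x : P × Q, x.1 ∈ A → ∃ U ∈ F, x ∈ U) ∧ #F ≤ cNum Q #A := by
  classical
  obtain ⟨l, B, hB, -, hle⟩ := exists_antichains_card_add_mul_le Q #A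
  refine ⟨(A ×ˢ univ).image (fun x : P × Fin l => {x.1} ×ˢ B x.2) ∪
    (univ.biUnion B)ᶜ.image fun q => A ×ˢ {q}, fun U hU => ?_, fun x hx => ?_, ?_⟩
  · rcases mem_union.mp hU with h | h
    · obtain ⟨x, -, rfl⟩ := mem_image.mp h
      exact isUniantichain_singleton_product _ (hB _)
    · obtain ⟨q, -, rfl⟩ := mem_image.mp h
      exact isUniantichain_product_singleton hA _
  · by_cases hq : x.2 ∈ univ.biUnion B
    · obtain ⟨j, -, hj⟩ := mem_biUnion.mp hq
      exact ⟨_, mem_union_left _ (mem_image.mpr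
        ⟨(x.1, j), mem_product.mpr ⟨hx, mem_univ _⟩, rfl⟩), by simpa [mem_product] using hj⟩
    · exact ⟨_, mem_union_right _ (mem_image.mpr ⟨x.2, mem_compl.mpr hq, rfl⟩),
        by simpa [mem_product] using hx⟩
  · have h1 := card_image_le (s := A ×ˢ univ) (f := fun x : P × Fin l => ({x.1} ×ˢ B x.2))
    have h2 := card_image_le (s := (univ.biUnion B)ᶜ) (f := fun q => A ×ˢ {q})
    have h3 := card_compl_add_card (univ.biUnion B)
    rw [card_product, card_univ, Fintype.card_fin] at h1
    exact (card_union_le _ _).trans (by omega)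

variable [Fintype P]

theorem exists_semichain (hP : IsCDecomposable P) (hQ : IsCDecomposable Q) :
    ∃ T : Finset (P × Q), IsSemichain T ∧
      #T = ∑ i ∈ Icc 1 (min (width P) (width Q)), lam P i * lam Q i := by
  classical
  obtain ⟨C, hC, hCd, hCcard⟩ := hP.exists_chains
  obtain ⟨D, hD, hDd, hDcard⟩ := hQ.exists_chains
  let f : Fin (min (width P) (width Q)) → Fin (width P) := Fin.castLE (min_le_left _ _)
  let g : Fin (min (width P) (width Q)) → Fin (width Q) := Fin.castLE (min_le_right _ _)
  have hf : ∀ i j, i ≠ j → f i ≠ f j := fun i j h h' => h (Fin.castLE_injective _ h')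
  have hg : ∀ i j, i ≠ j → g i ≠ g j := fun i j h h' => h (Fin.castLE_injective _ h')
  refine ⟨univ.biUnion fun i => C (f i) ×ˢ D (g i), isSemichain_biUnion_product
    (fun i _ => hC _) (fun i _ => hD _) (fun i _ j _ h => hCd _ _ (hf i j h))
    (fun i _ j _ h => hDd _ _ (hg i j h)), ?_⟩
  rw [card_biUnion fun i _ j _ h => disjoint_product.mpr (Or.inl (hCd _ _ (hf i j h)))]
  simp only [card_product, hCcard, hDcard]
  have shift := sum_Ico_add' (fun i => lam P i * lam Q i) 0 (min (width P) (width Q)) 1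
  rw [← range_eq_Ico, zero_add, Ico_add_one_right_eq_Icc] at shift
  rw [← shift, ← Fin.sum_univ_eq_sum_range fun i => lam P (i + 1) * lam Q (i + 1)]
  rfl

theorem exists_uniantichainCovering (hPd : IsDDecomposable P)
    (hQ : IsCDecomposable Q) :
    ∃ F : Finset (Finset (P × Q)), IsUniantichainCovering F ∧
      #F ≤ ∑ i ∈ Icc 1 (min (width P) (width Q)), lam P i * lam Q i := by
  classical
  obtain ⟨A, hA, hcov, hcard⟩ := hPd.exists_antichains
  choose F hF hFcov hFcard using fun j => exists_uniantichains_covering_product (Q := Q) (hA j)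
  refine ⟨univ.biUnion F, ⟨fun U hU => ?_, fun x => ?_⟩, ?_⟩
  · obtain ⟨j, -, hj⟩ := mem_biUnion.mp hU
    exact hF j U hj
  · obtain ⟨j, hj⟩ := hcov x.1
    obtain ⟨U, hU, hx⟩ := hFcov j x hj
    exact ⟨U, mem_biUnion.mpr ⟨j, mem_univ _, hU⟩, hx⟩
  · calc #(univ.biUnion F) ≤ ∑ j, cNum Q #(A j) :=
          card_biUnion_le.trans (sum_le_sum fun j _ => hFcard j)
      _ = ∑ i ∈ Icc 1 (width P), lam P i * lam Q i := by
          rw [sum_cNum_eq Q univ _ fun j _ => card_le_width (hA j)]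
          exact sum_congr rfl fun i hi => by rw [hcard i (mem_Icc.mp hi).1]
      _ = _ := sum_lam_mul_lam hQ

end Product

end SaksWest

theorem mainTheorem10 {P Q : Type*} [PartialOrder P] [Fintype P] [PartialOrder Q] [Fintype Q]
    (hPc : SaksWest.IsCDecomposable P) (hPd : SaksWest.IsDDecomposable P)
    (hQc : SaksWest.IsCDecomposable Q) :
    IsGreatest {n : ℕ | ∃ T : Finset (P × Q), SaksWest.IsSemichain T ∧ T.card = n}
        (∑ i ∈ Finset.Icc 1 (min (SaksWest.width P) (SaksWest.width Q)),
          SaksWest.lam P i * SaksWest.lam Q i) ∧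
      IsLeast {n : ℕ | ∃ F : Finset (Finset (P × Q)),
          SaksWest.IsUniantichainCovering F ∧ F.card = n}
        (∑ i ∈ Finset.Icc 1 (min (SaksWest.width P) (SaksWest.width Q)),
          SaksWest.lam P i * SaksWest.lam Q i) ∧
      ∑ i ∈ Finset.Icc 1 (min (SaksWest.width P) (SaksWest.width Q)),
          SaksWest.lam P i * SaksWest.lam Q i =
        ∑ j ∈ Finset.Icc 1 (SaksWest.height P), SaksWest.cNum Q (SaksWest.mu P j) := by
  obtain ⟨T, hT, hTcard⟩ := SaksWest.exists_semichain hPc hQc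
  obtain ⟨F, hF, hFcard⟩ := SaksWest.exists_uniantichainCovering hPd hQc
  refine ⟨⟨⟨T, hT, hTcard⟩, ?_⟩, ⟨⟨F, hF, ?_⟩, ?_⟩, ?_⟩
  · rintro _ ⟨T', hT', rfl⟩
    exact (hT'.card_le_card hF).trans hFcard
  · exact le_antisymm hFcard (hTcard ▸ hT.card_le_card hF)
  · rintro _ ⟨F', hF', rfl⟩
    exact hTcard ▸ hT.card_le_card hF'
  · rw [← SaksWest.sum_lam_mul_lam hQc, SaksWest.sum_lam_mul_lam_eq_sum_cNum_mu hPc]
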